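/- Theorem 1. Let $\mathcal{P}$ be a finite polysquare translation surface, that is, a connected surface obtained from $s\ge1$ unit squares with sides parallel to the axes (the atomic squares) by gluing every right edge to a left edge and every top edge to a bottom edge by translation, one-to-one. Let $\mathcal{M}=\mathcal{P}\times[0,1)$ be the associated polycube translation $3$-manifold, the cartesian product of $\mathcal{P}$ and the unit torus $[0,1)$; its atomic cubes are the products of the atomic squares with $[0,1)$, and its singular points are those lying over the singular points of $\mathcal{P}$ (the vertices with cone angle different from $2\pi$). A half-infinite geodesic is a curve $\mathcal{L}(t)$, $t\ge0$, parametrized by arc length, that is locally a straight line with a fixed direction and never meets a singular point. A half-infinite Kronecker sequence $\mathbf{v}_0+j\mathbf{v}$, $j=0,1,2,\ldots$, on $\mathcal{P}$ is a sequence $\mathcal{L}(j\vert\mathbf{v}\vert)$, where $\mathcal{L}$ is a half-infinite geodesic on $\mathcal{P}$ with direction $\mathbf{v}$ and $\mathcal{L}(0)=\mathbf{v}_0$. Let $\mathbf{v}=(v_1,v_2)\in\mathbb{R}^2$ be a Kronecker vector, that is, $v_1,v_2,1$ are linearly independent over $\mathbb{Q}$, and let $\mathbf{v}^*=(v_1,v_2,1)$.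 Then the following two statements are equivalent: (i) Every half-infinite Kronecker sequence $\mathbf{v}_0+j\mathbf{v}$, $j=0,1,2,\ldots$, on $\mathcal{P}$ is uniformly distributed, i.e. for every convex set $S$ in an atomic square, $$\lim_{J\to\infty}\frac{1}{J}\bigl\vert\{0\le j<J:\mathbf{v}_0+j\mathbf{v}\in S\}\bigr\vert=\frac{\lambda_2(S)}{s}.$$ (ii) Every half-infinite geodesic $\mathcal{L}(t)$, $t\ge0$, with direction $\mathbf{v}^*$ in $\mathcal{M}$ is uniformly distributed, i.e. for every convex set $S$ in an atomic cube, $$\lim_{T\to\infty}\frac{1}{T}\,\lambda_1\bigl(\{0\le t\le T:\mathcal{L}(t)\in S\}\bigr)=\frac{\lambda_3(S)}{s}.$$ Here $\lambda_d$ denotes $d$-dimensional Lebesgue measure. -/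

import Mathlib

open MeasureTheory Filter Topology

/-- A finite polysquare translation surface, given combinatorially.  Its atomic squares are unit
squares with sides parallel to the axes, indexed by the finite type `ι`.  The right edge of the
square `i` is glued by translation to the left edge of the square `right i`, and the top edge of
`i` is glued by translation to the bottom edge of `up i`.  The surface is non-empty and
connected: any square can be reached from any other one by crossing edges. -/
structure PolysquareSurface (ι : Type*) [Fintype ι] where
  right : Equiv.Perm ι
  up : Equiv.Perm ι
  nonempty : Nonempty ι
  connected : ∀ i j : ι, ∃ g ∈ Subgroup.closure {right, up}, g i = j

namespace PolysquareSurface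

variable {ι : Type*} [Fintype ι]

/-- The points of the surface.  Each atomic square contributes the half-open square `[0,1)²`; its
right and top edges are the left and bottom edges of neighbouring squares, so every point of the
surface that is not a vertex occurs exactly once.  A vertex with cone angle `2πk` is the
bottom-left corner of exactly `k` atomic squares, so every vertex with cone angle `2π` also occurs
exactly once.  Only the finitely many singular points (`k ≥ 2`) are listed several times, and no
geodesic passes through them. -/
@[ext]
structure Point (P : PolysquareSurface ι) where
  square : ι
  x : ℝ
  y : ℝ
  x_mem : x ∈ Set.Ico (0 : ℝ) 1
  y_mem : y ∈ Set.Ico (0 : ℝ) 1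

/-- A point is singular if it is a vertex whose cone angle is not `2π`.  For the bottom-left
corner of the square `i` the cone angle is `2π` exactly when going left and then down from `i`
leads to the same square as going down and then left. -/
def IsSingular (P : PolysquareSurface ι) (p : P.Point) : Prop :=
  p.x = 0 ∧ p.y = 0 ∧
    P.up.symm (P.right.symm p.square) ≠ P.right.symm (P.up.symm p.square)

/-- The point `p + w`, used only for a non-singular point `p` and all sufficiently small vectors
`w`.  Then the two exponents lie in `{-1, 0}`, both are `-1` only if `p` is a vertex with cone
angle `2π`, and this is the translation by `w` in the flat chart around `p`. -/
noncomputable def translate (P : PolysquareSurface ι) (p : P.Point) (w : ℝ × ℝ) : P.Point where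
  square := (P.right ^ ⌊p.x + w.1⌋) ((P.up ^ ⌊p.y + w.2⌋) p.square)
  x := Int.fract (p.x + w.1)
  y := Int.fract (p.y + w.2)
  x_mem := ⟨Int.fract_nonneg _, Int.fract_lt_one _⟩
  y_mem := ⟨Int.fract_nonneg _, Int.fract_lt_one _⟩

/-- The Euclidean length of a vector of the plane. -/
noncomputable def length₂ (v : ℝ × ℝ) : ℝ := √(v.1 ^ 2 + v.2 ^ 2)

/-- The Euclidean length of a vector of space. -/
noncomputable def length₃ (w : ℝ × ℝ × ℝ) : ℝ := √(w.1 ^ 2 + w.2.1 ^ 2 + w.2.2 ^ 2)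

/-- `L t`, `t ≥ 0`, is a half-infinite geodesic with direction `v` on the surface, parametrized by
arc length: it never meets a singular point, and near each of its points it is the straight line
with direction `v` through that point. Values `L t` with `t < 0` play no role. -/
def IsGeodesic (P : PolysquareSurface ι) (v : ℝ × ℝ) (L : ℝ → P.Point) : Prop :=
  ∀ t : ℝ, 0 ≤ t → ¬ P.IsSingular (L t) ∧
    ∀ᶠ h in 𝓝 (0 : ℝ), 0 ≤ t + h → L (t + h) = P.translate (L t) ((h / length₂ v) • v)

/-- `q j`, `j = 0, 1, 2, …`, is a half-infinite Kronecker sequence with step vector `v` on the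
surface: it runs through the points of a supporting half-infinite geodesic with direction `v` at
consecutive distances equal to the length of `v`. -/
def IsKroneckerSequence (P : PolysquareSurface ι) (v : ℝ × ℝ) (q : ℕ → P.Point) : Prop :=
  ∃ L : ℝ → P.Point, P.IsGeodesic v L ∧ ∀ j : ℕ, q j = L (j * length₂ v)

/-- The part of the surface formed by the set `S ⊆ [0,1)²` in the atomic square `i`. -/
def inSquare (P : PolysquareSurface ι) (i : ι) (S : Set (ℝ × ℝ)) : Set P.Point :=
  {p | p.square = i ∧ (p.x, p.y) ∈ S}

/-- A sequence of points is uniformly distributed on the surface with `s` atomic squares if it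
visits every convex set `S` in an atomic square with asymptotic frequency `λ₂(S) / s`. -/
def IsUniformlyDistributedSeq (P : PolysquareSurface ι) (q : ℕ → P.Point) : Prop :=
  ∀ (i : ι) (S : Set (ℝ × ℝ)), S ⊆ Set.Ico 0 1 ×ˢ Set.Ico 0 1 → Convex ℝ S →
    Tendsto (fun J : ℕ => ({j : ℕ | j < J ∧ q j ∈ P.inSquare i S}.ncard : ℝ) / J) atTop
      (𝓝 ((volume S).toReal / Fintype.card ι))

/-- The points of the polycube translation 3-manifold `P × [0,1)`, the cartesian product of the
surface and the unit torus `[0,1)`. -/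
abbrev Point₃ (P : PolysquareSurface ι) : Type _ := P.Point × Set.Ico (0 : ℝ) 1

/-- The point `p + w` of `P × [0,1)`, for small vectors `w`; the last coordinate is taken
modulo `1`. -/
noncomputable def translate₃ (P : PolysquareSurface ι) (p : P.Point₃) (w : ℝ × ℝ × ℝ) :
    P.Point₃ :=
  (P.translate p.1 (w.1, w.2.1),
    ⟨Int.fract ((p.2 : ℝ) + w.2.2), Int.fract_nonneg _, Int.fract_lt_one _⟩)

/-- `L t`, `t ≥ 0`, is a half-infinite geodesic with direction `w` in `P × [0,1)`, parametrized by
arc length. The singular points of `P × [0,1)` are those above the singular points of the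
surface. -/
def IsGeodesic₃ (P : PolysquareSurface ι) (w : ℝ × ℝ × ℝ) (L : ℝ → P.Point₃) : Prop :=
  ∀ t : ℝ, 0 ≤ t → ¬ P.IsSingular (L t).1 ∧
    ∀ᶠ h in 𝓝 (0 : ℝ), 0 ≤ t + h → L (t + h) = P.translate₃ (L t) ((h / length₃ w) • w)

/-- The part of `P × [0,1)` formed by the set `S ⊆ [0,1)³` in the atomic cube above the atomic
square `i`. -/
def inCube (P : PolysquareSurface ι) (i : ι) (S : Set (ℝ × ℝ × ℝ)) : Set P.Point₃ :=
  {p | p.1.square = i ∧ (p.1.x, p.1.y, (p.2 : ℝ)) ∈ S}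

/-- A half-infinite curve in `P × [0,1)`, where `P` has `s` atomic squares, is uniformly
distributed if the proportion of time it spends in any convex set `S` in an atomic cube tends to
`λ₃(S) / s`. -/
def IsUniformlyDistributedCurve₃ (P : PolysquareSurface ι) (L : ℝ → P.Point₃) : Prop :=
  ∀ (i : ι) (S : Set (ℝ × ℝ × ℝ)),
    S ⊆ Set.Ico 0 1 ×ˢ Set.Ico 0 1 ×ˢ Set.Ico 0 1 → Convex ℝ S →
    Tendsto (fun T : ℝ => (volume {t : ℝ | 0 ≤ t ∧ t ≤ T ∧ L t ∈ P.inCube i S}).toReal / T) atTop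
      (𝓝 ((volume S).toReal / Fintype.card ι))

end PolysquareSurface

/-- `v = (v₁, v₂)` is a Kronecker vector if `v₁, v₂, 1` are linearly independent over `ℚ`. -/
def IsKroneckerVector (v : ℝ × ℝ) : Prop :=
  LinearIndependent ℚ ![v.1, v.2, 1]

namespace PolysquareSurface

variable {ι : Type*} [Fintype ι]

/-! Parametrized with velocity `(v, 1)`, a geodesic of the 3-manifold is `(p t, z + t mod 1)`, where
`p` is a flow line of velocity `v` on the surface. At the times `u + j` with `u` fixed and `j = 0,
1, 2, …` the height is constant, and the points `p (u + j)` form a Kronecker sequence.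

(i) ⇒ (ii): the proportion of the time `[0, N]` spent in a convex `S` is the integral over `u ∈ [0,
1]` of the frequency with which `p (u + j)`, `j < N`, visits the slice of `S` at height `z + u mod
1`. Slices are convex, so (i) gives the limit for each `u`; dominated convergence and Fubini yield
`λ₃(S) / s`.

(ii) ⇒ (i): for a convex `S` at distance at least `δ` from the edges, a short cylinder over `S` in
the direction `(v, 1)` stays in the atomic cube. The curve `(p t, t mod 1)` spends time exactly `ε`
in it after each integer `j` with `p j ∈ S`, and none otherwise (up to null sets). Both the time and
the volume thus carry a factor `ε`, which cancels. Sets reaching the edges follow by approximation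
(`isUniformlyDistributedSeq_of_interior`). -/

/-- A half-infinite geodesic with direction `v`, parametrized with velocity `v` instead of by arc
length. -/
def IsFlowLine (P : PolysquareSurface ι) (v : ℝ × ℝ) (p : ℝ → P.Point) : Prop :=
  ∀ t : ℝ, 0 ≤ t → ¬ P.IsSingular (p t) ∧
    ∀ᶠ h in 𝓝 (0 : ℝ), 0 ≤ t + h → p (t + h) = P.translate (p t) (h • v)

/-! ### Reparametrization, projection and lifting of geodesics -/

theorem eventually_mul_nhds_zero {c : ℝ} {Q : ℝ → Prop} (h : ∀ᶠ x in 𝓝 (0 : ℝ), Q x) :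
    ∀ᶠ x in 𝓝 (0 : ℝ), Q (x * c) := by
  have : Tendsto (fun x : ℝ => x * c) (𝓝 0) (𝓝 0) := by
    simpa using (continuous_mul_const c).tendsto 0
  exact this.eventually h

theorem tendsto_sub_nhdsWithin_nhds_zero (a : ℝ) (s : Set ℝ) :
    Tendsto (fun b : ℝ => b - a) (𝓝[s] a) (𝓝 0) := by
  have := (continuous_sub_right a).tendsto a
  rw [sub_self] at this
  exact this.mono_left nhdsWithin_le_nhds

theorem IsGeodesic.isFlowLine {P : PolysquareSurface ι} {v : ℝ × ℝ} {L : ℝ → P.Point}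
    (hL : P.IsGeodesic v L) (hv : 0 < length₂ v) :
    P.IsFlowLine v (fun t => L (t * length₂ v)) := by
  intro t ht
  refine ⟨(hL _ (by positivity)).1, ?_⟩
  filter_upwards [eventually_mul_nhds_zero (c := length₂ v)
    (hL (t * length₂ v) (by positivity)).2] with h hh h0
  have := hh (by rw [← add_mul]; positivity)
  rw [← add_mul, mul_div_cancel_right₀ _ hv.ne'] at this
  exact this

theorem IsFlowLine.isGeodesic {P : PolysquareSurface ι} {v : ℝ × ℝ} {p : ℝ → P.Point}
    (hp : P.IsFlowLine v p) (hv : 0 < length₂ v) :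
    P.IsGeodesic v (fun t => p (t / length₂ v)) := by
  intro t ht
  refine ⟨(hp _ (by positivity)).1, ?_⟩
  filter_upwards [eventually_mul_nhds_zero (c := (length₂ v)⁻¹)
    (hp (t / length₂ v) (by positivity)).2] with h hh h0
  have := hh (by rw [← div_eq_mul_inv, ← add_div]; positivity)
  rw [← div_eq_mul_inv, ← add_div] at this
  exact this

theorem IsFlowLine.shift {P : PolysquareSurface ι} {v : ℝ × ℝ} {p : ℝ → P.Point}
    (hp : P.IsFlowLine v p) {u : ℝ} (hu : 0 ≤ u) : P.IsFlowLine v (fun t => p (u + t)) := by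
  intro t ht
  obtain ⟨h1, h2⟩ := hp (u + t) (by positivity)
  refine ⟨h1, ?_⟩
  filter_upwards [h2] with h hh h0
  rw [← add_assoc]
  exact hh (by linarith)

theorem IsGeodesic₃.isFlowLine {P : PolysquareSurface ι} {w : ℝ × ℝ × ℝ} {L : ℝ → P.Point₃}
    (hL : P.IsGeodesic₃ w L) (hw : 0 < length₃ w) :
    P.IsFlowLine (w.1, w.2.1) (fun t => (L (t * length₃ w)).1) := by
  intro t ht
  refine ⟨(hL _ (by positivity)).1, ?_⟩
  filter_upwards [eventually_mul_nhds_zero (c := length₃ w)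
    (hL (t * length₃ w) (by positivity)).2] with h hh h0
  have := hh (by rw [← add_mul]; positivity)
  rw [← add_mul, mul_div_cancel_right₀ _ hw.ne'] at this
  rw [this]
  rfl

/-- Height minus time is locally constant modulo `1`. Congruence modulo `1` is an equivalence
relation, so the connectedness of `[0, ∞)` makes it constant. -/
theorem IsGeodesic₃.height_eq {P : PolysquareSurface ι} {v : ℝ × ℝ} {L : ℝ → P.Point₃}
    (hL : P.IsGeodesic₃ (v.1, v.2, 1) L) (hw : 0 < length₃ (v.1, v.2, 1)) {t : ℝ} (ht : 0 ≤ t) :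
    ((L (t * length₃ (v.1, v.2, 1))).2 : ℝ) = Int.fract (((L 0).2 : ℝ) + t) := by
  set c := length₃ (v.1, v.2, 1) with hc
  have key : ((∃ n : ℤ, ((L (0 * c)).2 : ℝ) - 0 - (((L (t * c)).2 : ℝ) - t) = n)) := by
    refine isPreconnected_Ici.induction₂ (s := Set.Ici (0 : ℝ))
      (fun a b => ∃ n : ℤ, ((L (a * c)).2 : ℝ) - a - (((L (b * c)).2 : ℝ) - b) = n)
      ?_ ?_ ?_ (Set.self_mem_Ici) ht
    · intro a ha
      rw [Set.mem_Ici] at ha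
      have h1 := eventually_mul_nhds_zero (c := c) (hL (a * c) (by positivity)).2
      filter_upwards [(tendsto_sub_nhdsWithin_nhds_zero a _).eventually h1, self_mem_nhdsWithin]
        with b hb hb0
      rw [Set.mem_Ici] at hb0
      rw [← add_mul, add_sub_cancel, mul_div_cancel_right₀ _ hw.ne'] at hb
      rw [hb (by positivity)]
      simp only [translate₃, Prod.smul_mk, smul_eq_mul, mul_one]
      refine ⟨⌊((L (a * c)).2 : ℝ) + (b - a)⌋, ?_⟩
      rw [Int.fract]
      ring
    · rintro a b d - - - ⟨m, hm⟩ ⟨n, hn⟩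
      exact ⟨m + n, by push_cast; linarith⟩
    · rintro a b - - ⟨m, hm⟩
      exact ⟨-m, by push_cast; linarith⟩
  obtain ⟨n, hn⟩ := key
  rw [zero_mul] at hn
  symm
  rw [Int.fract_eq_iff]
  exact ⟨(L (t * c)).2.2.1, (L (t * c)).2.2.2, n, by linarith⟩

theorem IsFlowLine.isGeodesic₃ {P : PolysquareSurface ι} {v : ℝ × ℝ} {p : ℝ → P.Point}
    (hp : P.IsFlowLine v p) (hw : 0 < length₃ (v.1, v.2, 1)) :
    P.IsGeodesic₃ (v.1, v.2, 1) (fun t => (p (t / length₃ (v.1, v.2, 1)),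
      ⟨Int.fract (t / length₃ (v.1, v.2, 1)), Int.fract_nonneg _, Int.fract_lt_one _⟩)) := by
  set c := length₃ (v.1, v.2, 1) with hc
  intro t ht
  refine ⟨(hp _ (by positivity)).1, ?_⟩
  filter_upwards [eventually_mul_nhds_zero (c := c⁻¹) (hp (t / c) (by positivity)).2] with h hh h0
  have := hh (by rw [← div_eq_mul_inv, ← add_div]; positivity)
  rw [← div_eq_mul_inv, ← add_div] at this
  simp only [translate₃, this]
  refine Prod.ext rfl (Subtype.ext ?_)
  simp only [Prod.smul_mk, smul_eq_mul, mul_one]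
  rw [add_div, Int.fract_eq_fract]
  exact ⟨⌊t / c⌋, by rw [Int.fract]; ring⟩

/-! ### Straight motion inside one atomic square -/

/-- Inside an atomic square, `translate` acts as the translation of the plane. -/
theorem translate_eq_iff (P : PolysquareSurface ι) (p : P.Point) (i : ι) {a b : ℝ} {w : ℝ × ℝ}
    (ha : a ∈ Set.Ico (0 : ℝ) 1) (hb : b ∈ Set.Ico (0 : ℝ) 1)
    (ha' : a + w.1 ∈ Set.Ico (0 : ℝ) 1) (hb' : b + w.2 ∈ Set.Ico (0 : ℝ) 1) :
    ((P.translate p w).square = i ∧ (P.translate p w).x = a + w.1 ∧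
      (P.translate p w).y = b + w.2) ↔ (p.square = i ∧ p.x = a ∧ p.y = b) := by
  -- Here `x` and `r` differ by an integer, and two points of `[0, 1)` that do so coincide.
  have aux : ∀ {x r d : ℝ}, x ∈ Set.Ico (0 : ℝ) 1 → r ∈ Set.Ico (0 : ℝ) 1 →
      Int.fract (x + d) = r + d → x = r := by
    intro x r d hx hr h
    obtain ⟨-, -, z, hz⟩ := Int.fract_eq_iff.1 h
    have h1 : x - r = z := by linarith
    have h2 : (-1 : ℝ) < z := by linarith [hx.1, hr.2]
    have h3 : (z : ℝ) < 1 := by linarith [hx.2, hr.1]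
    have : z = 0 := by
      have h2' : -1 < z := by exact_mod_cast h2
      have h3' : z < 1 := by exact_mod_cast h3
      omega
    rw [this] at h1
    simpa [sub_eq_zero] using h1
  have hfa : ⌊a + w.1⌋ = 0 := Int.floor_eq_zero_iff.2 ha'
  have hfb : ⌊b + w.2⌋ = 0 := Int.floor_eq_zero_iff.2 hb'
  constructor
  · rintro ⟨h1, h2, h3⟩
    have hx : p.x = a := aux p.x_mem ha h2
    have hy : p.y = b := aux p.y_mem hb h3
    simp only [translate, hx, hy, hfa, hfb, zpow_zero, Equiv.Perm.coe_one, id] at h1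
    exact ⟨h1, hx, hy⟩
  · rintro ⟨h1, h2, h3⟩
    simp [translate, h1, h2, h3, hfa, hfb, Int.fract_eq_self.2 ha', Int.fract_eq_self.2 hb']

/-- A flow line runs along a straight segment as long as this segment stays in an atomic
square. -/
theorem IsFlowLine.segment {P : PolysquareSurface ι} {v : ℝ × ℝ} {p : ℝ → P.Point}
    (hp : P.IsFlowLine v p) (i : ι) {a b x y : ℝ} (ha : 0 ≤ a) (hab : a ≤ b)
    (hx : ∀ t ∈ Set.Icc a b, x + (t - a) * v.1 ∈ Set.Ico (0 : ℝ) 1)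
    (hy : ∀ t ∈ Set.Icc a b, y + (t - a) * v.2 ∈ Set.Ico (0 : ℝ) 1) :
    ((p a).square = i ∧ (p a).x = x ∧ (p a).y = y) ↔
      ((p b).square = i ∧ (p b).x = x + (b - a) * v.1 ∧ (p b).y = y + (b - a) * v.2) := by
  -- Lying on the segment at time `s` and at time `t` are equivalent for nearby times, and
  -- equivalence propagates along the connected interval `[a, b]`. It also works backwards in time,
  -- which later recovers `p j` from `p (u + j)`.
  let A : ℝ → Prop := fun t =>
    (p t).square = i ∧ (p t).x = x + (t - a) * v.1 ∧ (p t).y = y + (t - a) * v.2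
  have key : A a ↔ A b := by
    refine isPreconnected_Icc.induction₂ (s := Set.Icc a b) (fun s t => A s ↔ A t)
      ?_ ?_ ?_ (Set.left_mem_Icc.2 hab) (Set.right_mem_Icc.2 hab)
    · intro s hs
      filter_upwards [(tendsto_sub_nhdsWithin_nhds_zero s _).eventually
        (hp s (ha.trans hs.1)).2, self_mem_nhdsWithin] with t ht hts
      rw [add_sub_cancel] at ht
      have e1 : x + (t - a) * v.1 = x + (s - a) * v.1 + ((t - s) • v).1 := by
        simp only [Prod.smul_fst, smul_eq_mul]; ring
      have e2 : y + (t - a) * v.2 = y + (s - a) * v.2 + ((t - s) • v).2 := by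
        simp only [Prod.smul_snd, smul_eq_mul]; ring
      have := P.translate_eq_iff (p s) i (w := (t - s) • v) (hx s hs) (hy s hs)
        (e1 ▸ hx t hts) (e2 ▸ hy t hts)
      rw [← e1, ← e2, ← ht (ha.trans hts.1)] at this
      exact this.symm
    · intro r s t _ _ _ h1 h2
      exact h1.trans h2
    · intro r s _ _ h1
      exact h1.symm
  simpa [A] using key

/-! ### Measurability of the visiting times -/

/-- The times at which the curve `(p t, z + t)` in `P × [0,1)` visits the set `S` in the atomic
cube above the square `i`. -/
def visitTimes (P : PolysquareSurface ι) (p : ℝ → P.Point) (z : ℝ) (i : ι)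
    (S : Set (ℝ × ℝ × ℝ)) : Set ℝ :=
  {t | 0 ≤ t ∧ (p t).square = i ∧ ((p t).x, (p t).y, Int.fract (z + t)) ∈ S}

/-- Near each time the curve is affine up to integer parts. Fixing the three integer parts leaves a
convex set of times, hence an interval, so locally the set is a countable union of intervals.
Countably many such neighbourhoods cover `[0, ∞)`. -/
theorem IsFlowLine.measurableSet_visitTimes {P : PolysquareSurface ι} {v : ℝ × ℝ}
    {p : ℝ → P.Point} (hp : P.IsFlowLine v p) (z : ℝ) (i : ι) {S : Set (ℝ × ℝ × ℝ)}
    (hS : Convex ℝ S) : MeasurableSet (P.visitTimes p z i S) := by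
  have loc : ∀ t x y : ℝ, ∀ j : ι, MeasurableSet {h : ℝ |
      (P.right ^ ⌊x + h * v.1⌋) ((P.up ^ ⌊y + h * v.2⌋) j) = i ∧
      (Int.fract (x + h * v.1), Int.fract (y + h * v.2), Int.fract (z + (t + h))) ∈ S} := by
    intro t x y j
    have : {h : ℝ | (P.right ^ ⌊x + h * v.1⌋) ((P.up ^ ⌊y + h * v.2⌋) j) = i ∧
        (Int.fract (x + h * v.1), Int.fract (y + h * v.2), Int.fract (z + (t + h))) ∈ S} =
        ⋃ (k : ℤ) (l : ℤ) (m : ℤ) (_ : (P.right ^ k) ((P.up ^ l) j) = i),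
        {h : ℝ | ((k : ℝ) ≤ x + h * v.1 ∧ x + h * v.1 < k + 1) ∧
          ((l : ℝ) ≤ y + h * v.2 ∧ y + h * v.2 < l + 1) ∧
          ((m : ℝ) ≤ z + (t + h) ∧ z + (t + h) < m + 1) ∧
          (x + h * v.1 - k, y + h * v.2 - l, z + (t + h) - m) ∈ S} := by
      ext h
      simp only [Set.mem_iUnion, Set.mem_ofPred_eq, exists_prop, ← Int.floor_eq_iff]
      constructor
      · rintro ⟨h1, h2⟩
        exact ⟨_, _, _, h1, rfl, rfl, rfl, h2⟩
      · rintro ⟨k, l, m, h1, rfl, rfl, rfl, h2⟩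
        exact ⟨h1, h2⟩
    rw [this]
    refine MeasurableSet.iUnion fun k => MeasurableSet.iUnion fun l => MeasurableSet.iUnion fun m =>
      MeasurableSet.iUnion fun _ => Set.OrdConnected.measurableSet (Convex.ordConnected ?_)
    rintro a ⟨⟨a1, a2⟩, ⟨a3, a4⟩, ⟨a5, a6⟩, a7⟩ b ⟨⟨b1, b2⟩, ⟨b3, b4⟩, ⟨b5, b6⟩, b7⟩ r s hr hs hrs
    have hs' : s = 1 - r := by linarith
    have conv : ∀ {q : ℝ → ℝ} {α β : ℝ}, (∀ x, q x = α + x * β) →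
        q (r • a + s • b) = r * q a + s * q b := by
      intro q α β hq
      simp only [hq, smul_eq_mul, hs']; ring
    have cle : ∀ {q : ℝ → ℝ} {α β : ℝ} (n : ℝ), (∀ x, q x = α + x * β) → n ≤ q a → q a < n + 1 →
        n ≤ q b → q b < n + 1 → n ≤ q (r • a + s • b) ∧ q (r • a + s • b) < n + 1 := by
      intro q α β n hq h1 h2 h3 h4
      rw [conv hq]
      exact convex_Ico n (n + 1) ⟨h1, h2⟩ ⟨h3, h4⟩ hr hs hrs
    refine ⟨cle (q := fun h => x + h * v.1) k (fun _ => rfl) a1 a2 b1 b2,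
      cle (q := fun h => y + h * v.2) l (fun _ => rfl) a3 a4 b3 b4,
      cle (q := fun h => z + (t + h)) (α := z + t) (β := 1) m (fun _ => by ring) a5 a6 b5 b6, ?_⟩
    convert hS a7 b7 hr hs hrs using 1
    simp only [Prod.smul_mk, Prod.mk_add_mk, smul_eq_mul, hs', Prod.mk.injEq]
    exact ⟨by ring, by ring, by ring⟩
  have nb : ∀ t ∈ Set.Ici (0 : ℝ), ∃ U ∈ 𝓝 t, MeasurableSet (P.visitTimes p z i S ∩ U) := by
    intro t ht
    obtain ⟨r, hr, hball⟩ := Metric.eventually_nhds_iff_ball.1 (hp t ht).2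
    refine ⟨Metric.ball t r, Metric.ball_mem_nhds t hr, ?_⟩
    have hm := ((measurable_id.sub_const t : Measurable fun s : ℝ => s - t)
      (loc t (p t).x (p t).y (p t).square)).inter
      ((measurableSet_Ici (a := (0 : ℝ))).inter (measurableSet_ball (x := t) (ε := r)))
    convert hm using 1
    ext s
    simp only [visitTimes, Set.mem_inter_iff, Set.mem_ofPred_eq, Set.mem_preimage, Set.mem_Ici, id]
    constructor
    · rintro ⟨⟨h0, h1, h2⟩, hb⟩
      have := hball (s - t) (by simpa [Real.dist_eq] using hb) (by simpa using h0)
      rw [add_sub_cancel] at this ⊢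
      rw [this] at h1 h2
      exact ⟨⟨h1, h2⟩, h0, hb⟩
    · rintro ⟨⟨h1, h2⟩, h0, hb⟩
      have := hball (s - t) (by simpa [Real.dist_eq] using hb) (by simpa using h0)
      rw [add_sub_cancel] at this h2
      rw [this]
      exact ⟨⟨h0, h1, h2⟩, hb⟩
  choose! U hU hUm using nb
  obtain ⟨T, hT, hTc, hTU⟩ := TopologicalSpace.countable_cover_nhdsWithin
    (s := Set.Ici (0 : ℝ)) (f := U) (fun t ht => mem_nhdsWithin_of_mem_nhds (hU t ht))
  have : P.visitTimes p z i S = ⋃ t ∈ T, (P.visitTimes p z i S ∩ U t) := by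
    rw [← Set.inter_iUnion₂]
    exact (Set.inter_eq_left.2 fun t ht => hTU ht.1).symm
  rw [this]
  exact MeasurableSet.biUnion hTc fun t ht => hUm t (hT ht)

end PolysquareSurface

/-! ### Slices of convex sets and Fubini -/

/-- The horizontal slice of a set in space at height `z`. -/
def horizontalSlice (S : Set (ℝ × ℝ × ℝ)) (z : ℝ) : Set (ℝ × ℝ) := {q | (q.1, q.2, z) ∈ S}

theorem convex_horizontalSlice {S : Set (ℝ × ℝ × ℝ)} (hS : Convex ℝ S) (z : ℝ) :
    Convex ℝ (horizontalSlice S z) := by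
  intro a ha b hb r s hr hs hrs
  have := hS ha hb hr hs hrs
  simp only [Prod.smul_mk, Prod.mk_add_mk, smul_eq_mul] at this
  rw [show r * z + s * z = z by rw [← add_mul, hrs, one_mul]] at this
  exact this

/-- Fubini with the height as the second factor. A convex set need not be Borel, but it and its
slices are null measurable, which suffices. -/
theorem toReal_volume_eq_integral_horizontalSlice {S : Set (ℝ × ℝ × ℝ)} (hS : Convex ℝ S)
    (hsub : S ⊆ Set.Ico 0 1 ×ˢ Set.Ico 0 1 ×ˢ Set.Ico 0 1) :
    (volume S).toReal = ∫ z in (0 : ℝ)..1, (volume (horizontalSlice S z)).toReal := by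
  have hN : NullMeasurableSet S (volume : Measure (ℝ × ℝ × ℝ)) := by
    have : (volume : Measure (ℝ × ℝ × ℝ)).IsAddHaarMeasure :=
      inferInstanceAs ((volume : Measure ℝ).prod (volume : Measure (ℝ × ℝ))).IsAddHaarMeasure
    exact hS.nullMeasurableSet volume
  set S' : Set ((ℝ × ℝ) × ℝ) := MeasurableEquiv.prodAssoc ⁻¹' S with hS'
  have hmp := volume_preserving_prodAssoc (α₁ := ℝ) (β₁ := ℝ) (γ₁ := ℝ)
  have hN' : NullMeasurableSet S' ((volume : Measure (ℝ × ℝ)).prod (volume : Measure ℝ)) :=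
    hN.preimage hmp.quasiMeasurePreserving
  have hAE : AEMeasurable (S'.indicator (1 : (ℝ × ℝ) × ℝ → ENNReal))
      ((volume : Measure (ℝ × ℝ)).prod (volume : Measure ℝ)) :=
    (aemeasurable_indicator_const_iff (1 : ENNReal)).2 hN'
  have hsl : ∀ z : ℝ, ∫⁻ q : ℝ × ℝ, S'.indicator (1 : (ℝ × ℝ) × ℝ → ENNReal) (q, z) =
      volume (horizontalSlice S z) := by
    intro z
    have : (volume : Measure (ℝ × ℝ)).IsAddHaarMeasure :=
      inferInstanceAs ((volume : Measure ℝ).prod (volume : Measure ℝ)).IsAddHaarMeasure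
    rw [← lintegral_indicator_one₀ ((convex_horizontalSlice hS z).nullMeasurableSet volume)]
    rfl
  have hV : volume S = ∫⁻ z : ℝ, volume (horizontalSlice S z) := by
    rw [← hmp.measure_preimage hN, ← hS', Measure.volume_eq_prod (ℝ × ℝ) ℝ,
      ← lintegral_indicator_one₀ hN', lintegral_prod_symm _ hAE]
    exact lintegral_congr hsl
  have hm : AEMeasurable (fun z : ℝ => volume (horizontalSlice S z)) volume := by
    have := hAE.lintegral_prod_left'
    simpa only [hsl] using this
  have hle : ∀ z, volume (horizontalSlice S z) < ⊤ := by
    intro z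
    refine (measure_mono (t := Set.Ico 0 1 ×ˢ Set.Ico 0 1) fun q hq => ?_).trans_lt
      (?_ : volume (Set.Ico (0 : ℝ) 1 ×ˢ Set.Ico (0 : ℝ) 1) < ⊤)
    · exact ⟨(hsub hq).1, (hsub hq).2.1⟩
    · rw [Measure.volume_eq_prod, Measure.prod_prod]
      simp
  rw [hV, ← integral_toReal hm (Eventually.of_forall hle),
    intervalIntegral.integral_of_le zero_le_one, integral_Ioc_eq_integral_Ioo,
    ← integral_Ico_eq_integral_Ioo]
  symm
  refine setIntegral_eq_integral_of_forall_compl_eq_zero fun z hz => ?_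
  have : horizontalSlice S z = ∅ := Set.eq_empty_of_forall_notMem fun q hq => hz (hsub hq).2.2
  simp [this]

/-! ### Time averages along integers -/

/-- Monotonicity squeezes `g T` between the values at `⌊T⌋` and `⌊T⌋ + 1`, both asymptotic to `T`.
-/
theorem tendsto_div_atTop_iff_nat {g : ℝ → ℝ} (hg : Monotone g) {l : ℝ} :
    Tendsto (fun T : ℝ => g T / T) atTop (𝓝 l) ↔
      Tendsto (fun N : ℕ => g N / N) atTop (𝓝 l) := by
  refine ⟨fun h => h.comp tendsto_natCast_atTop_atTop, fun h => ?_⟩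
  have hfl : Tendsto (fun T : ℝ => ⌊T⌋₊) atTop atTop := tendsto_nat_floor_atTop
  have h1 : Tendsto (fun T : ℝ => (⌊T⌋₊ : ℝ) / T) atTop (𝓝 1) := tendsto_nat_floor_div_atTop
  have h2 : Tendsto (fun T : ℝ => ((⌊T⌋₊ + 1 : ℕ) : ℝ) / T) atTop (𝓝 1) := by
    have := h1.add tendsto_inv_atTop_zero
    rw [add_zero] at this
    refine this.congr fun T => ?_
    push_cast
    rw [add_div, one_div]
  have lo := (h.comp hfl).mul h1
  have hi := (h.comp ((tendsto_add_atTop_nat 1).comp hfl)).mul h2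
  rw [mul_one] at lo hi
  refine tendsto_of_tendsto_of_tendsto_of_le_of_le' lo hi ?_ ?_
  · filter_upwards [eventually_ge_atTop 1] with T hT
    have : 0 < ⌊T⌋₊ := Nat.floor_pos.2 hT
    simp only [Function.comp]
    rw [div_mul_div_cancel₀ (by positivity)]
    exact div_le_div_of_nonneg_right (hg (Nat.floor_le (by linarith))) (by linarith)
  · filter_upwards [eventually_ge_atTop 1] with T hT
    simp only [Function.comp]
    rw [div_mul_div_cancel₀ (by positivity)]
    refine div_le_div_of_nonneg_right (hg ?_) (by linarith)
    push_cast
    exact (Nat.lt_floor_add_one T).le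

theorem tendsto_comp_div_iff {g : ℝ → ℝ} {c : ℝ} (hc : 0 < c) {l : Filter ℝ} :
    Tendsto (fun T : ℝ => g (T / c)) atTop l ↔ Tendsto g atTop l := by
  refine ⟨fun h => ?_, fun h => h.comp (tendsto_id.atTop_div_const hc)⟩
  have := h.comp (tendsto_id.atTop_mul_const hc)
  refine this.congr fun T => ?_
  simp [mul_div_cancel_right₀ _ hc.ne']

theorem toReal_volume_inter_Icc_eq_sum {E : Set ℝ} (hE : MeasurableSet E) (N : ℕ) :
    (volume (E ∩ Set.Icc 0 (N : ℝ))).toReal =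
      ∑ j ∈ Finset.range N, ∫ u in (0 : ℝ)..1, E.indicator (1 : ℝ → ℝ) (u + j) := by
  have hii : ∀ a b : ℝ, IntervalIntegrable (E.indicator (1 : ℝ → ℝ)) volume a b := by
    intro a b
    have : IntervalIntegrable (1 : ℝ → ℝ) volume a b := intervalIntegrable_const
    exact ⟨this.1.indicator hE, this.2.indicator hE⟩
  have hsum := intervalIntegral.sum_integral_adjacent_intervals
    (f := E.indicator (1 : ℝ → ℝ)) (μ := volume) (a := fun k : ℕ => (k : ℝ)) (n := N)
    (fun k _ => hii _ _)
  have : ∀ j : ℕ, ∫ u in (0 : ℝ)..1, E.indicator (1 : ℝ → ℝ) (u + j) =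
      ∫ u in (j : ℝ)..(j + 1 : ℕ), E.indicator (1 : ℝ → ℝ) u := by
    intro j
    rw [intervalIntegral.integral_comp_add_right]
    push_cast
    rw [zero_add, add_comm]
  simp only [this, hsum, Nat.cast_zero]
  rw [intervalIntegral.integral_of_le (Nat.cast_nonneg N), ← integral_Icc_eq_integral_Ioc,
    integral_indicator_one hE, measureReal_def, Measure.restrict_apply hE]

namespace PolysquareSurface

variable {ι : Type*} [Fintype ι]

/-- The bridge used in both directions. Rescaling time by `c` scales both the visiting time and `T`
by `c`, so the proportion is unchanged; then integer `T` suffice, and `[0, N]` is cut into unit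
intervals. -/
theorem tendsto_visit_proportion_iff {P : PolysquareSurface ι} {v : ℝ × ℝ} {p : ℝ → P.Point}
    (hp : P.IsFlowLine v p) (z : ℝ) (i : ι) {S : Set (ℝ × ℝ × ℝ)} (hS : Convex ℝ S)
    {L : ℝ → P.Point₃} {c : ℝ} (hc : 0 < c) (hL1 : ∀ t, 0 ≤ t → (L (t * c)).1 = p t)
    (hL2 : ∀ t, 0 ≤ t → ((L (t * c)).2 : ℝ) = Int.fract (z + t)) {l : ℝ} :
    Tendsto (fun T : ℝ => (volume {t : ℝ | 0 ≤ t ∧ t ≤ T ∧ L t ∈ P.inCube i S}).toReal / T) atTop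
      (𝓝 l) ↔
    Tendsto (fun N : ℕ => (∑ j ∈ Finset.range N, ∫ u in (0 : ℝ)..1,
      (P.visitTimes p z i S).indicator (1 : ℝ → ℝ) (u + j)) / N) atTop (𝓝 l) := by
  have hE := hp.measurableSet_visitTimes z i hS
  set E := P.visitTimes p z i S with hEdef
  simp only [← toReal_volume_inter_Icc_eq_sum hE]
  have hfin : ∀ T : ℝ, volume (E ∩ Set.Icc 0 T) ≠ ⊤ := fun T =>
    ((measure_mono Set.inter_subset_right).trans_lt (by simp)).ne
  have hmono : Monotone fun T : ℝ => (volume (E ∩ Set.Icc 0 T)).toReal := fun a b hab =>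
    ENNReal.toReal_mono (hfin b) (measure_mono
      (Set.inter_subset_inter_right _ (Set.Icc_subset_Icc_right hab)))
  rw [← tendsto_div_atTop_iff_nat hmono,
    ← tendsto_comp_div_iff (g := fun T => (volume (E ∩ Set.Icc 0 T)).toReal / T) hc]
  refine tendsto_congr fun T => ?_
  have hset : {t : ℝ | 0 ≤ t ∧ t ≤ T ∧ L t ∈ P.inCube i S} =
      (fun t => c⁻¹ * t) ⁻¹' (E ∩ Set.Icc 0 (T / c)) := by
    ext t
    simp only [hEdef, visitTimes, inCube, Set.mem_ofPred_eq, Set.mem_preimage, Set.mem_inter_iff,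
      Set.mem_Icc]
    have e : c⁻¹ * t * c = t := by field_simp
    have e1 : c⁻¹ * t ≤ T / c ↔ t ≤ T := by
      rw [inv_mul_eq_div, div_le_div_iff_of_pos_right hc]
    have e2 : 0 ≤ c⁻¹ * t ↔ 0 ≤ t := by
      rw [inv_mul_eq_div, le_div_iff₀ hc, zero_mul]
    rw [e1, e2]
    constructor
    · rintro ⟨h0, hT, h1, h2⟩
      have q1 := hL1 _ (e2.2 h0)
      have q2 := hL2 _ (e2.2 h0)
      rw [e] at q1 q2
      rw [← q1, ← q2]
      exact ⟨⟨h0, h1, h2⟩, h0, hT⟩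
    · rintro ⟨⟨h0, h1, h2⟩, -, hT⟩
      have q1 := hL1 _ (e2.2 h0)
      have q2 := hL2 _ (e2.2 h0)
      rw [e] at q1 q2
      rw [← q1, ← q2] at h2
      rw [← q1] at h1
      exact ⟨h0, hT, h1, h2⟩
  rw [hset, Real.volume_preimage_mul_left (inv_ne_zero hc.ne'), inv_inv, abs_of_pos hc,
    ENNReal.toReal_mul, ENNReal.toReal_ofReal hc.le]
  rw [div_div_eq_mul_div, mul_comm]

end PolysquareSurface

theorem ncard_lt_eq_sum_indicator (Q : Set ℕ) (N : ℕ) :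
    ({j : ℕ | j < N ∧ j ∈ Q}.ncard : ℝ) = ∑ j ∈ Finset.range N, Q.indicator (1 : ℕ → ℝ) j := by
  classical
  have : {j : ℕ | j < N ∧ j ∈ Q} = ((Finset.range N).filter (· ∈ Q) : Finset ℕ) := by
    ext j; simp
  rw [this, Set.ncard_coe_finset, Finset.card_filter]
  push_cast
  refine Finset.sum_congr rfl fun j _ => ?_
  simp [Set.indicator_apply]

theorem IsKroneckerVector.length₂_pos {v : ℝ × ℝ} (hv : IsKroneckerVector v) :
    0 < PolysquareSurface.length₂ v := by
  have h : v.1 ≠ 0 := LinearIndependent.ne_zero 0 hv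
  exact Real.sqrt_pos.2 (by positivity)

namespace PolysquareSurface

variable {ι : Type*} [Fintype ι]

theorem length₃_pos (v : ℝ × ℝ) : 0 < length₃ (v.1, v.2, 1) :=
  Real.sqrt_pos.2 (by positivity)

/-! ### From Kronecker sequences to geodesics -/

theorem isUniformlyDistributedCurve₃_of_flowLines {P : PolysquareSurface ι} {v : ℝ × ℝ}
    (h : ∀ p : ℝ → P.Point, P.IsFlowLine v p → P.IsUniformlyDistributedSeq fun j : ℕ => p j)
    {L : ℝ → P.Point₃} (hL : P.IsGeodesic₃ (v.1, v.2, 1) L) :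
    P.IsUniformlyDistributedCurve₃ L := by
  intro i S hsub hS
  have hc := length₃_pos v
  have hp : P.IsFlowLine v (fun t => (L (t * length₃ (v.1, v.2, 1))).1) := hL.isFlowLine hc
  set p : ℝ → P.Point := fun t => (L (t * length₃ (v.1, v.2, 1))).1 with hpdef
  set z : ℝ := ((L 0).2 : ℝ) with hz
  rw [tendsto_visit_proportion_iff hp z i hS hc (fun t _ => rfl) (fun t ht => hL.height_eq hc ht)]
  have hE := hp.measurableSet_visitTimes z i hS
  set E := P.visitTimes p z i S with hEdef
  have hm : ∀ j : ℕ, Measurable fun u : ℝ => E.indicator (1 : ℝ → ℝ) (u + j) := fun j =>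
    ((measurable_one (α := ℝ) (β := ℝ)).indicator hE).comp (measurable_id.add_const _)
  have hb : ∀ x : ℝ, 0 ≤ E.indicator (1 : ℝ → ℝ) x ∧ E.indicator (1 : ℝ → ℝ) x ≤ 1 := fun x =>
    ⟨Set.indicator_nonneg (fun _ _ => zero_le_one) x,
      Set.indicator_le_self' (fun _ _ => zero_le_one) x⟩
  have hint : ∀ j : ℕ, IntervalIntegrable (fun u : ℝ => E.indicator (1 : ℝ → ℝ) (u + j))
      volume 0 1 := by
    intro j
    refine (intervalIntegrable_const (c := (1 : ℝ))).mono_fun (hm j).aestronglyMeasurable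
      (Eventually.of_forall fun u => ?_)
    simp only [norm_one, Real.norm_eq_abs, abs_of_nonneg (hb _).1]
    exact (hb _).2
  have hF : ∀ N : ℕ, (∑ j ∈ Finset.range N, ∫ u in (0 : ℝ)..1,
      E.indicator (1 : ℝ → ℝ) (u + j)) / N =
      ∫ u in (0 : ℝ)..1, (∑ j ∈ Finset.range N, E.indicator (1 : ℝ → ℝ) (u + j)) / N := by
    intro N
    rw [intervalIntegral.integral_div, intervalIntegral.integral_finsetSum fun j _ => hint j]
  simp only [hF]
  -- The slice area at height `z + u mod 1` has period `1` in `u`, so the starting height `z` does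
  -- not affect its integral over a period.
  have hlim : (volume S).toReal / Fintype.card ι = ∫ u in (0 : ℝ)..1,
      (volume (horizontalSlice S (Int.fract (z + u)))).toReal / Fintype.card ι := by
    rw [intervalIntegral.integral_div, toReal_volume_eq_integral_horizontalSlice hS hsub]
    congr 1
    have hper : Function.Periodic
        (fun x : ℝ => (volume (horizontalSlice S (Int.fract x))).toReal) 1 := fun x => by
      simp only [Int.fract_add_one]
    have e1 := intervalIntegral.integral_comp_add_left (a := 0) (b := 1)
      (fun x : ℝ => (volume (horizontalSlice S (Int.fract x))).toReal) z
    rw [e1, add_zero, hper.intervalIntegral_add_eq z 0, zero_add,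
      intervalIntegral.integral_of_le zero_le_one, intervalIntegral.integral_of_le zero_le_one,
      integral_Ioc_eq_integral_Ioo, integral_Ioc_eq_integral_Ioo]
    refine setIntegral_congr_fun measurableSet_Ioo fun x hx => ?_
    simp only [Int.fract_eq_self.2 ⟨hx.1.le, hx.2⟩]
  rw [hlim]
  refine intervalIntegral.tendsto_integral_filter_of_dominated_convergence (fun _ => (1 : ℝ))
    (Eventually.of_forall fun N => ?_) (Eventually.of_forall fun N => Eventually.of_forall fun u _ =>
      ?_) intervalIntegrable_const (Eventually.of_forall fun u hu => ?_)
  · exact ((Finset.measurable_sum _ fun j _ => hm j).div_const _).aestronglyMeasurable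
  · rw [Real.norm_eq_abs, abs_of_nonneg
      (div_nonneg (Finset.sum_nonneg fun j _ => (hb _).1) (Nat.cast_nonneg N))]
    refine div_le_one_of_le₀ ?_ (Nat.cast_nonneg N)
    calc _ ≤ ∑ j ∈ Finset.range N, (1 : ℝ) := Finset.sum_le_sum fun j _ => (hb _).2
      _ = N := by simp
  · rw [Set.uIoc_of_le zero_le_one] at hu
    -- For fixed `u`, adding `j` leaves the height unchanged, so a single planar slice is tested
    -- along the flow line shifted by `u`.
    have := h _ (hp.shift hu.1.le) i (horizontalSlice S (Int.fract (z + u)))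
      (fun q hq => ⟨(hsub hq).1, (hsub hq).2.1⟩) (convex_horizontalSlice hS _)
    refine this.congr fun N => ?_
    congr 1
    have e := ncard_lt_eq_sum_indicator {j : ℕ | p (u + j) ∈
      P.inSquare i (horizontalSlice S (Int.fract (z + u)))} N
    refine e.trans (Finset.sum_congr rfl fun j _ => ?_)
    have hiff : p (u + j) ∈ P.inSquare i (horizontalSlice S (Int.fract (z + u))) ↔ u + j ∈ E := by
      simp only [hEdef, visitTimes, inSquare, horizontalSlice, Set.mem_ofPred_eq, ← add_assoc,
        Int.fract_add_natCast]
      have : 0 ≤ u + j := by linarith [hu.1, Nat.cast_nonneg (α := ℝ) j]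
      simp [this]
    by_cases hj : u + j ∈ E <;> simp [hj, hiff]

/-! ### From geodesics to Kronecker sequences -/

/-- The oblique cylinder of height `ε` with base `S` in the direction `(v, 1)`. -/
def obliqueCylinder (v : ℝ × ℝ) (ε : ℝ) (S : Set (ℝ × ℝ)) : Set (ℝ × ℝ × ℝ) :=
  {q | q.2.2 ∈ Set.Ico 0 ε ∧ (q.1 - q.2.2 * v.1, q.2.1 - q.2.2 * v.2) ∈ S}

theorem convex_obliqueCylinder (v : ℝ × ℝ) (ε : ℝ) {S : Set (ℝ × ℝ)} (hS : Convex ℝ S) :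
    Convex ℝ (obliqueCylinder v ε S) := by
  rintro a ⟨ha1, ha2⟩ b ⟨hb1, hb2⟩ r s hr hs hrs
  refine ⟨convex_Ico 0 ε ha1 hb1 hr hs hrs, ?_⟩
  convert hS ha2 hb2 hr hs hrs using 1
  simp only [Prod.smul_mk, Prod.mk_add_mk, Prod.fst_add, Prod.snd_add, Prod.smul_fst,
    Prod.smul_snd, smul_eq_mul, Prod.mk.injEq]
  exact ⟨by ring, by ring⟩

/-- Every slice at a height in `[0, ε)` is a translate of `S`, and all others are empty. -/
theorem toReal_volume_obliqueCylinder (v : ℝ × ℝ) {ε : ℝ} (hε : 0 ≤ ε) (hε1 : ε ≤ 1)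
    {S : Set (ℝ × ℝ)} (hS : Convex ℝ S)
    (hsub : obliqueCylinder v ε S ⊆ Set.Ico 0 1 ×ˢ Set.Ico 0 1 ×ˢ Set.Ico 0 1) :
    (volume (obliqueCylinder v ε S)).toReal = ε * (volume S).toReal := by
  rw [toReal_volume_eq_integral_horizontalSlice (convex_obliqueCylinder v ε hS) hsub]
  have hsl : ∀ z, (volume (horizontalSlice (obliqueCylinder v ε S) z)).toReal =
      (Set.Ico 0 ε).indicator (fun _ => (volume S).toReal) z := by
    intro z
    by_cases hz : z ∈ Set.Ico 0 ε
    · rw [Set.indicator_of_mem hz]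
      have : horizontalSlice (obliqueCylinder v ε S) z =
          (fun q : ℝ × ℝ => q + (-(z * v.1), -(z * v.2))) ⁻¹' S := by
        ext q
        exact ⟨fun h => h.2, fun h => ⟨hz, h⟩⟩
      have inv : (volume : Measure (ℝ × ℝ)).IsAddHaarMeasure :=
        inferInstanceAs ((volume : Measure ℝ).prod (volume : Measure ℝ)).IsAddHaarMeasure
      rw [this, measure_preimage_add_right]
    · rw [Set.indicator_of_notMem hz]
      have : horizontalSlice (obliqueCylinder v ε S) z = ∅ :=
        Set.eq_empty_of_forall_notMem fun q hq => hz hq.1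
      simp [this]
  simp only [hsl]
  rw [intervalIntegral.integral_of_le zero_le_one, integral_Ioc_eq_integral_Ioo,
    ← integral_Ico_eq_integral_Ioo, setIntegral_indicator measurableSet_Ico, setIntegral_const,
    Set.Ico_inter_Ico]
  simp [measureReal_def, hε, hε1]

theorem tendsto_frequency_of_isUniformlyDistributedCurve₃ {P : PolysquareSurface ι} {v : ℝ × ℝ}
    (h : ∀ L : ℝ → P.Point₃, P.IsGeodesic₃ (v.1, v.2, 1) L → P.IsUniformlyDistributedCurve₃ L)
    {p : ℝ → P.Point} (hp : P.IsFlowLine v p) (i : ι) {δ : ℝ} (hδ : 0 < δ)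
    {S : Set (ℝ × ℝ)} (hsub : S ⊆ Set.Icc δ (1 - δ) ×ˢ Set.Icc δ (1 - δ)) (hS : Convex ℝ S) :
    Tendsto (fun J : ℕ => ({j : ℕ | j < J ∧ p j ∈ P.inSquare i S}.ncard : ℝ) / J) atTop
      (𝓝 ((volume S).toReal / Fintype.card ι)) := by
  have hc := length₃_pos v
  -- During time `ε` each coordinate moves by less than `δ`, so no segment starting in `S` leaves
  -- its square.
  obtain ⟨ε, hε, hε1, hv1, hv2⟩ : ∃ ε : ℝ, 0 < ε ∧ ε ≤ 1 ∧ ε * |v.1| < δ ∧ ε * |v.2| < δ := by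
    have hd : 0 < |v.1| + |v.2| + δ := by positivity
    refine ⟨δ / (|v.1| + |v.2| + δ), by positivity, ?_, ?_, ?_⟩
    · rw [div_le_one hd]; linarith [abs_nonneg v.1, abs_nonneg v.2]
    all_goals
      rw [div_mul_eq_mul_div, div_lt_iff₀ hd]
      nlinarith [abs_nonneg v.1, abs_nonneg v.2]
  have hshift : ∀ {a b w : ℝ}, a ∈ Set.Icc δ (1 - δ) → ε * |b| < δ → w ∈ Set.Icc 0 ε →
      a + w * b ∈ Set.Ico (0 : ℝ) 1 := by
    intro a b w ha hb hw
    have h1 : |w * b| < δ := by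
      rw [abs_mul, abs_of_nonneg hw.1]
      exact (mul_le_mul_of_nonneg_right hw.2 (abs_nonneg b)).trans_lt hb
    obtain ⟨h2, h3⟩ := abs_lt.1 h1
    exact ⟨by linarith [ha.1], by linarith [ha.2]⟩
  have hKsub : obliqueCylinder v ε S ⊆ Set.Ico 0 1 ×ˢ Set.Ico 0 1 ×ˢ Set.Ico 0 1 := by
    rintro ⟨a, b, w⟩ ⟨hw, hq⟩
    have hq' := hsub hq
    have hw' := Set.Ico_subset_Icc_self hw
    have e1 := hshift hq'.1 hv1 hw'
    have e2 := hshift hq'.2 hv2 hw'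
    simp only [sub_add_cancel] at e1 e2
    exact ⟨e1, e2, hw.1, hw.2.trans_le hε1⟩
  have hKc := convex_obliqueCylinder v ε hS
  have key := h _ (hp.isGeodesic₃ hc) i _ hKsub hKc
  rw [tendsto_visit_proportion_iff hp 0 i hKc hc
    (fun t _ => by simp [mul_div_cancel_right₀ _ hc.ne'])
    (fun t _ => by simp [mul_div_cancel_right₀ _ hc.ne']),
    toReal_volume_obliqueCylinder v hε.le hε1 hS hKsub] at key
  -- At time `u + j` the height is `u`, and sliding back along the cylinder to its base at height
  -- `0` lands on `p j`. The endpoints of `(0, 1)` are negligible.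
  have hvisit : ∀ j : ℕ, ∀ u ∈ Set.Ioo (0 : ℝ) 1,
      u + j ∈ P.visitTimes p 0 i (obliqueCylinder v ε S) ↔
        (p j ∈ P.inSquare i S ∧ u < ε) := by
    intro j u hu
    have hj : (0 : ℝ) ≤ j := Nat.cast_nonneg j
    have hpos : 0 ≤ u + j := by linarith [hu.1]
    have hf : Int.fract (0 + (u + j)) = u := by
      rw [zero_add, Int.fract_add_natCast, Int.fract_eq_self.2 ⟨hu.1.le, hu.2⟩]
    simp only [visitTimes, obliqueCylinder, inSquare, Set.mem_ofPred_eq, hf, Set.mem_Ico]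
    have seg : ∀ x y : ℝ, (x, y) ∈ S → u < ε → (((p j).square = i ∧ (p j).x = x ∧ (p j).y = y) ↔
        ((p (u + j)).square = i ∧ (p (u + j)).x = x + u * v.1 ∧
          (p (u + j)).y = y + u * v.2)) := by
      intro x y hxy hue
      have hm : ∀ t ∈ Set.Icc (j : ℝ) (u + j), t - j ∈ Set.Icc 0 ε := fun t ht =>
        ⟨by linarith [ht.1], by linarith [ht.2]⟩
      have := hp.segment i (a := j) (b := u + j) (x := x) (y := y) hj (by linarith [hu.1])
        (fun t ht => hshift (hsub hxy).1 hv1 (hm t ht))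
        (fun t ht => hshift (hsub hxy).2 hv2 (hm t ht))
      rwa [add_sub_cancel_right] at this
    constructor
    · rintro ⟨-, h1, ⟨-, hue⟩, h3⟩
      obtain ⟨e1, e2, e3⟩ := (seg _ _ h3 hue).2 ⟨h1, by ring, by ring⟩
      exact ⟨⟨e1, by rw [e2, e3]; exact h3⟩, hue⟩
    · rintro ⟨⟨h1, h2⟩, hue⟩
      obtain ⟨e1, e2, e3⟩ := (seg _ _ h2 hue).1 ⟨h1, rfl, rfl⟩
      refine ⟨hpos, e1, ⟨hu.1.le, hue⟩, ?_⟩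
      rw [e2, e3, add_sub_cancel_right, add_sub_cancel_right]
      exact h2
  have hint : ∀ j : ℕ, ∫ u in (0 : ℝ)..1,
      (P.visitTimes p 0 i (obliqueCylinder v ε S)).indicator (1 : ℝ → ℝ) (u + j) =
      ε * {j : ℕ | p j ∈ P.inSquare i S}.indicator (1 : ℕ → ℝ) j := by
    intro j
    have : ∀ u ∈ Set.Ioo (0 : ℝ) 1,
        (P.visitTimes p 0 i (obliqueCylinder v ε S)).indicator (1 : ℝ → ℝ) (u + j) =
        (Set.Iio ε).indicator
          (fun _ => {j : ℕ | p j ∈ P.inSquare i S}.indicator (1 : ℕ → ℝ) j) u := by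
      intro u hu
      have := hvisit j u hu
      by_cases h1 : p j ∈ P.inSquare i S <;> by_cases h2 : u < ε <;>
        simp [this, h1, h2]
    rw [intervalIntegral.integral_of_le zero_le_one, integral_Ioc_eq_integral_Ioo,
      setIntegral_congr_fun measurableSet_Ioo this, setIntegral_indicator measurableSet_Iio,
      setIntegral_const, Set.Ioo_inter_Iio]
    simp [measureReal_def, hε.le, hε1]
  simp only [hint, ← Finset.mul_sum, ← ncard_lt_eq_sum_indicator] at key
  have := key.const_mul ε⁻¹
  rw [mul_div_assoc, inv_mul_cancel_left₀ hε.ne'] at this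
  refine this.congr fun N => ?_
  rw [mul_div_assoc, inv_mul_cancel_left₀ hε.ne']
  rfl

/-! ### Convex sets reaching the edges -/

/-- It suffices to test uniform distribution on the convex sets that keep away from the edges of
the atomic squares. -/
theorem isUniformlyDistributedSeq_of_interior {P : PolysquareSurface ι} {q : ℕ → P.Point}
    (h : ∀ (i : ι) (δ : ℝ) (S : Set (ℝ × ℝ)), 0 < δ →
      S ⊆ Set.Icc δ (1 - δ) ×ˢ Set.Icc δ (1 - δ) → Convex ℝ S →
      Tendsto (fun J : ℕ => ({j : ℕ | j < J ∧ q j ∈ P.inSquare i S}.ncard : ℝ) / J) atTop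
        (𝓝 ((volume S).toReal / Fintype.card ι))) :
    P.IsUniformlyDistributedSeq q := by
  classical
  intro i S hsub hS
  have hs : (0 : ℝ) < Fintype.card ι := by
    have := P.nonempty
    exact_mod_cast Fintype.card_pos
  set s : ℝ := (Fintype.card ι : ℝ) with hsdef
  let f : ι → Set (ℝ × ℝ) → ℕ → ℝ := fun k A J =>
    ({j : ℕ | j < J ∧ q j ∈ P.inSquare k A}.ncard : ℝ)
  have hfin : ∀ (J : ℕ) (Q : ℕ → Prop), {j : ℕ | j < J ∧ Q j}.Finite := fun J Q =>
    (Set.finite_Iio J).subset fun j hj => hj.1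
  -- The set `S' = S ∩ B` with `B = [δ, 1 - δ]²` bounds `S` from below. The boundary frame is not
  -- convex, so visits to `S \ B` are bounded by all visits outside the copies of `B` in every
  -- square, a count obtained by complement. The frame has area `1 - (1 - 2δ)² ≤ 4δ`.
  have hbound : ∀ δ : ℝ, 0 < δ → δ < 1 / 2 → ∃ S' : Set (ℝ × ℝ),
      (volume S').toReal ≤ (volume S).toReal ∧ (volume S).toReal - 4 * δ ≤ (volume S').toReal ∧
      (∀ J, f i S' J ≤ f i S J) ∧
      ∃ B : Set (ℝ × ℝ), 1 - 4 * δ ≤ (volume B).toReal ∧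
      (∀ J, f i S J ≤ f i S' J + (J - ∑ k, f k B J)) ∧
      Tendsto (fun J => f i S' J / J) atTop (𝓝 ((volume S').toReal / s)) ∧
      ∀ k, Tendsto (fun J => f k B J / J) atTop (𝓝 ((volume B).toReal / s)) := by
    intro δ hδ hδ2
    set B : Set (ℝ × ℝ) := Set.Icc δ (1 - δ) ×ˢ Set.Icc δ (1 - δ) with hB
    have hBc : Convex ℝ B := (convex_Icc _ _).prod (convex_Icc _ _)
    have hvB : volume B = ENNReal.ofReal ((1 - 2 * δ) ^ 2) := by
      rw [hB, Measure.volume_eq_prod, Measure.prod_prod, Real.volume_Icc,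
        ← ENNReal.ofReal_mul (by linarith)]
      congr 1; ring
    have hvB' : (volume B).toReal = (1 - 2 * δ) ^ 2 := by
      rw [hvB, ENNReal.toReal_ofReal (by positivity)]
    set Q : Set (ℝ × ℝ) := Set.Ico 0 1 ×ˢ Set.Ico 0 1 with hQ
    have hvQ : volume Q = 1 := by
      rw [hQ, Measure.volume_eq_prod, Measure.prod_prod]; simp
    have hBQ : B ⊆ Q := Set.prod_mono
      (fun t ht => ⟨by linarith [ht.1], by linarith [ht.2]⟩)
      (fun t ht => ⟨by linarith [ht.1], by linarith [ht.2]⟩)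
    have hBm : MeasurableSet B := measurableSet_Icc.prod measurableSet_Icc
    have hSfin : volume S ≠ ⊤ := ((measure_mono hsub).trans_lt (by rw [hvQ]; simp)).ne
    have hSBfin : volume (S ∩ B) ≠ ⊤ :=
      ((measure_mono Set.inter_subset_left).trans_lt hSfin.lt_top).ne
    refine ⟨S ∩ B, ENNReal.toReal_mono hSfin (measure_mono Set.inter_subset_left), ?_, ?_,
      B, by rw [hvB']; nlinarith, ?_, h i δ _ hδ Set.inter_subset_right (hS.inter hBc),
      fun k => h k δ _ hδ subset_rfl hBc⟩
    · have e1 : volume S ≤ volume (S ∩ B) + volume (Q \ B) := by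
        refine (measure_mono fun x hx => ?_).trans (measure_union_le _ _)
        by_cases hxB : x ∈ B
        · exact Or.inl ⟨hx, hxB⟩
        · exact Or.inr ⟨hsub hx, hxB⟩
      have e2 : (volume (Q \ B)).toReal = 1 - (1 - 2 * δ) ^ 2 := by
        rw [measure_sdiff hBQ hBm.nullMeasurableSet (by rw [hvB]; simp),
          ENNReal.toReal_sub_of_le (measure_mono hBQ) (by rw [hvQ]; simp), hvQ, hvB']
        simp
      have e3 : volume (Q \ B) ≠ ⊤ :=
        ((measure_mono Set.sdiff_subset).trans_lt (by rw [hvQ]; simp)).ne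
      have e4 := ENNReal.toReal_mono (ENNReal.add_ne_top.2 ⟨hSBfin, e3⟩) e1
      rw [ENNReal.toReal_add hSBfin e3, e2] at e4
      nlinarith
    · intro J
      refine Nat.cast_le.2 (Set.ncard_le_ncard ?_ (hfin _ _))
      exact fun j hj => ⟨hj.1, hj.2.1, hj.2.2.1⟩
    · intro J
      simp only [f]
      have hsum : ∑ k, ({j : ℕ | j < J ∧ q j ∈ P.inSquare k B}.ncard : ℝ) =
          ({j : ℕ | j < J ∧ ((q j).x, (q j).y) ∈ B}.ncard : ℝ) := by
        have e : ∀ k, ({j : ℕ | j < J ∧ q j ∈ P.inSquare k B}.ncard : ℝ) =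
            ∑ j ∈ Finset.range J, if (q j).square = k ∧ ((q j).x, (q j).y) ∈ B then (1 : ℝ) else 0 :=
          fun k => (ncard_lt_eq_sum_indicator {j | q j ∈ P.inSquare k B} J).trans
            (Finset.sum_congr rfl fun j _ => by simp [Set.indicator_apply, inSquare])
        have e' := ncard_lt_eq_sum_indicator {j | ((q j).x, (q j).y) ∈ B} J
        simp only [e]
        rw [Finset.sum_comm]
        refine Eq.trans (Finset.sum_congr rfl fun j _ => ?_) e'.symm
        by_cases hj : ((q j).x, (q j).y) ∈ B <;> simp [hj]
      -- Inclusion–exclusion: the intersection of the two sets on the left consists of the visits to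
      -- `S ∩ B`, and their union has at most `J` elements.
      have hcover : {j : ℕ | j < J ∧ q j ∈ P.inSquare i S}.ncard +
          {j : ℕ | j < J ∧ ((q j).x, (q j).y) ∈ B}.ncard ≤
          {j : ℕ | j < J ∧ q j ∈ P.inSquare i (S ∩ B)}.ncard + J := by
        rw [← Set.ncard_union_add_ncard_inter _ _ (hfin _ _) (hfin _ _), add_comm]
        refine add_le_add (Set.ncard_le_ncard ?_ (hfin _ _)) ?_
        · exact fun j hj => ⟨hj.1.1, hj.1.2.1, hj.1.2.2, hj.2.2⟩
        · calc _ ≤ (Set.Iio J).ncard := Set.ncard_le_ncard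
                (fun j hj => hj.elim (fun h => h.1) (fun h => h.1)) (Set.finite_Iio J)
            _ = J := by simp [Set.ncard_eq_toFinset_card']
      rw [hsum]
      have : (_ : ℝ) ≤ _ := Nat.cast_le.2 hcover
      push_cast at this
      linarith
  rw [Metric.tendsto_nhds]
  intro η hη
  -- the error in the limit is at most `4δ / s + 4δ`
  obtain ⟨δ, hδ, hδ2, hδη⟩ : ∃ δ : ℝ, 0 < δ ∧ δ < 1 / 2 ∧ 4 * δ / s + 4 * δ < η := by
    refine ⟨min (1 / 4) (η / (2 * (4 / s + 4))), by positivity,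
      (min_le_left _ _).trans_lt (by norm_num), ?_⟩
    have h1 := min_le_right (1 / 4 : ℝ) (η / (2 * (4 / s + 4)))
    have h2 : (4 / s + 4) * min (1 / 4 : ℝ) (η / (2 * (4 / s + 4))) ≤ η / 2 := by
      refine (mul_le_mul_of_nonneg_left h1 (by positivity)).trans_eq ?_
      field_simp
    calc _ = (4 / s + 4) * min (1 / 4 : ℝ) (η / (2 * (4 / s + 4))) := by ring
      _ < η := by linarith
  obtain ⟨S', hS'1, hS'2, hlow, B, hvB, hup, hlimS, hlimB⟩ := hbound δ hδ hδ2
  -- The `s` squares contribute `λ₂(B) / s` each, so the overall frequency outside the copies of `B`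
  -- tends to `1 - λ₂(B) ≤ 4δ`.
  have hlimB' : Tendsto (fun J : ℕ => ∑ k, f k B J / J) atTop (𝓝 (volume B).toReal) := by
    have := tendsto_finsetSum Finset.univ fun k _ => hlimB k
    rw [Finset.sum_const, Finset.card_univ, nsmul_eq_mul, mul_div_cancel₀ _ hs.ne'] at this
    exact this
  have hlimU := hlimS.add (hlimB'.const_sub 1)
  have hsd : (volume S).toReal / s - 4 * δ / s ≤ (volume S').toReal / s := by
    rw [← sub_div]; exact div_le_div_of_nonneg_right hS'2 hs.le
  have hsd' : (volume S').toReal / s ≤ (volume S).toReal / s :=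
    div_le_div_of_nonneg_right hS'1 hs.le
  have h4 : 0 < 4 * δ / s := by positivity
  have lo := hlimS.eventually_const_lt (u := (volume S).toReal / s - η) (by linarith)
  have hi := hlimU.eventually_lt_const (u := (volume S).toReal / s + η) (by linarith)
  filter_upwards [lo, hi, eventually_gt_atTop 0] with J h1 h2 hJ
  have hJ' : (0 : ℝ) < J := by exact_mod_cast hJ
  have l1 : f i S' J / J ≤ f i S J / J := div_le_div_of_nonneg_right (hlow J) hJ'.le
  have u1 : f i S J / J ≤ f i S' J / J + (1 - ∑ k, f k B J / J) := by
    rw [← Finset.sum_div]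
    refine (div_le_div_of_nonneg_right (hup J) hJ'.le).trans_eq ?_
    rw [add_div, sub_div, div_self hJ'.ne']
  rw [Real.dist_eq, abs_lt]
  change -η < f i S J / J - _ ∧ f i S J / J - _ < η
  exact ⟨by linarith, by linarith⟩

end PolysquareSurface

theorem theorem1 {ι : Type*} [Fintype ι] (P : PolysquareSurface ι) (v : ℝ × ℝ)
    (hv : IsKroneckerVector v) :
    (∀ q : ℕ → P.Point, P.IsKroneckerSequence v q → P.IsUniformlyDistributedSeq q) ↔
      (∀ L : ℝ → P.Point₃, P.IsGeodesic₃ (v.1, v.2, 1) L → P.IsUniformlyDistributedCurve₃ L) := by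
  have hl := hv.length₂_pos
  constructor
  · intro h L hL
    refine PolysquareSurface.isUniformlyDistributedCurve₃_of_flowLines
      (fun p hp => h _ ⟨_, hp.isGeodesic hl, ?_⟩) hL
    intro j
    rw [mul_div_cancel_right₀ _ hl.ne']
  · rintro h q ⟨L, hL, hq⟩
    refine PolysquareSurface.isUniformlyDistributedSeq_of_interior fun i δ S hδ hsub hS => ?_
    simp only [hq]
    exact PolysquareSurface.tendsto_frequency_of_isUniformlyDistributedCurve₃ h
      (hL.isFlowLine hl) i hδ hsub hS
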